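/- **Proposition 4.7.** Let $K$ be a field of characteristic $0$ and let $H=(V,E)$ be a finite hypergraph ($E$ is a set of subsets of $V$, none properly contained in another) with $n=|V|\ge 3$ vertices. Let $A=K[x_v : v\in V]$, let $I_H\subset A$ be the ideal generated by the monomials $\prod_{v\in e}x_v$, $e\in E$, and let $R=A/I_H$. For $i\ge 0$ and $b\in\mathbb Z^V$ let $b_{i,b}(H)$ be the multigraded Betti number of $R$, that is, the exponent of $A(-b)$ in the $i$-th module of the $\mathbb Z^V$-graded minimal free resolution of $R$ over $A$; write $|b|=\sum_{v}b_v$. For $v\in V$ the card $H-v$ is the hypergraph on $V\setminus\{v\}$ whose edges are the edges of $H$ not containing $v$. Then the multigraded Betti numbers $b_{i,b}(H)$ with $|b|<n$ are reconstructible from the cards, in the following two senses. 1. (Labelled cards.) Let $b\in\mathbb Z^V$ with $|b|<n$ and let $i\ge 0$. For every $v\in V$ with $b_v=0$, $$b_{i,b}(H)=b_{i,\,b|_{V\setminus\{v\}}}(H-v),$$ and if $b_v\neq 0$ for all $v\in V$, then $b_{i,b}(H)=0$. 2. (Cards up to isomorphism.) Let $H'$ be a finite hypergraph on a vertex set $V'$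 with the same deck as $H$, i.e. there is a bijection $\sigma:V\to V'$ such that $H-v\cong H'-\sigma(v)$ for all $v\in V$. Then for every integer $j<n$ and every sequence $(\beta_i)_{i\ge 0}$ of non-negative integers that is not identically zero, the number of $b\in\mathbb Z^V$ with $|b|=j$ and $b_{i,b}(H)=\beta_i$ for all $i$ equals the number of $b\in\mathbb Z^{V'}$ with $|b|=j$ and $b_{i,b}(H')=\beta_i$ for all $i$. -/

import Mathlib

universe u v

namespace HypergraphReconstruction

/-- A hypergraph on the vertex set `V`: a set of subsets of `V`, the edges, no one of which is
properly contained in another. -/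
@[ext]
structure SimpleHypergraph (V : Type u) where
  edges : Set (Finset V)
  edge_eq_of_subset : ∀ e₁ ∈ edges, ∀ e₂ ∈ edges, e₁ ⊆ e₂ → e₁ = e₂

namespace SimpleHypergraph

/-- The card `H - x`: the subhypergraph of `H` induced on the vertex set `V \ {x}`; its edges are
the edges of `H` that do not contain `x`. -/
def deleteVertex {V : Type u} (H : SimpleHypergraph V) (x : V) :
    SimpleHypergraph {w : V // w ≠ x} where
  edges := {e | e.map (Function.Embedding.subtype _) ∈ H.edges}
  edge_eq_of_subset _ h₁ _ h₂ h :=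
    Finset.map_injective _ (H.edge_eq_of_subset _ h₁ _ h₂ (Finset.map_subset_map.2 h))

/-- Isomorphism of hypergraphs: a bijection between the vertex sets that carries the edges of the
one exactly to the edges of the other. -/
def IsIsomorphic {V : Type u} {V' : Type v} (H : SimpleHypergraph V) (H' : SimpleHypergraph V') :
    Prop :=
  ∃ f : V ≃ V', ∀ e : Finset V, e.map f.toEmbedding ∈ H'.edges ↔ e ∈ H.edges

/-- Two hypergraphs have the same deck: the collections of their cards agree up to isomorphism of
the cards (with multiplicity). -/
def SameDeck {V : Type u} {V' : Type v} (H : SimpleHypergraph V) (H' : SimpleHypergraph V') :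
    Prop :=
  ∃ σ : V ≃ V', ∀ x : V, IsIsomorphic (H.deleteVertex x) (H'.deleteVertex (σ x))

/-- The edge ideal `I_H` in `K[x_v : v ∈ V]`, generated by the squarefree monomials
`∏_{x ∈ e} x` for the edges `e`; it is the Stanley-Reisner ideal of the independent complex. -/
noncomputable def edgeIdeal (K : Type v) [Field K] {V : Type u} (H : SimpleHypergraph V) :
    Ideal (MvPolynomial V K) :=
  Ideal.span ((fun e : Finset V => ∏ x ∈ e, MvPolynomial.X x) '' H.edges)

end SimpleHypergraph

/-- The polynomial `p` is homogeneous of multidegree `b ∈ ℤ^V` (zero is, for every `b`). -/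
def IsMultihomogeneous {K : Type v} [Field K] {V : Type u} (p : MvPolynomial V K) (b : V → ℤ) :
    Prop :=
  ∀ m ∈ p.support, ∀ x : V, (m x : ℤ) = b x

/-- A `ℤ^V`-graded minimal free resolution
`⋯ → F₂ → F₁ → F₀ → A/I → 0` of the `A`-module `A/I`, where `A = K[x_v : v ∈ V]`.
`F i` is the free module on the finite set `ι i`, and the basis element `a` has multidegree
`deg i a`, that is, `F i = ⨁_a A(-deg i a)`. -/
structure MinimalResolution {K : Type v} [Field K] {V : Type u} (I : Ideal (MvPolynomial V K)) where
  ι : ℕ → Type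
  finite_ι : ∀ i, Finite (ι i)
  deg : ∀ i, ι i → V → ℤ
  /-- the differentials `F (i+1) → F i` -/
  d : ∀ i, (ι (i + 1) →₀ MvPolynomial V K) →ₗ[MvPolynomial V K] (ι i →₀ MvPolynomial V K)
  /-- the augmentation `F 0 → A/I` -/
  aug : (ι 0 →₀ MvPolynomial V K) →ₗ[MvPolynomial V K] (MvPolynomial V K ⧸ I)
  /-- the differentials have multidegree zero -/
  d_graded : ∀ i (a : ι (i + 1)) (c : ι i),
    IsMultihomogeneous (d i (Finsupp.single a 1) c) (deg (i + 1) a - deg i c)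
  /-- the augmentation has multidegree zero -/
  aug_graded : ∀ a : ι 0, ∃ p : MvPolynomial V K, IsMultihomogeneous p (deg 0 a) ∧
    aug (Finsupp.single a 1) = Ideal.Quotient.mk I p
  aug_surjective : Function.Surjective aug
  exact_zero : Function.Exact (d 0) aug
  exact_succ : ∀ i, Function.Exact (d (i + 1)) (d i)
  /-- minimality: the image of every differential `F (i+1) → F i` lies in `𝔪 F i`, where `𝔪` is
  the ideal generated by the variables -/
  minimal : ∀ i (f : ι (i + 1) →₀ MvPolynomial V K) (c : ι i),
    MvPolynomial.constantCoeff (d i f c) = 0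

namespace MinimalResolution

/-- The number of basis elements of `F i` of multidegree `b`, that is, the exponent of `A(-b)` in
`F i`. -/
noncomputable def rank {K : Type v} [Field K] {V : Type u} {I : Ideal (MvPolynomial V K)}
    (F : MinimalResolution I) (i : ℕ) (b : V → ℤ) : ℕ :=
  Nat.card {a : F.ι i // F.deg i a = b}

end MinimalResolution

section Existence

variable {K : Type v} [Field K] {V : Type u}

theorem IsMultihomogeneous.zero (b : V → ℤ) : IsMultihomogeneous (0 : MvPolynomial V K) b := by
  intro m hm
  simp at hm

open Classical in
/-- The part of multidegree `b` of a polynomial. -/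
noncomputable def part (b : V → ℤ) : MvPolynomial V K →ₗ[K] MvPolynomial V K :=
  MvPolynomial.weightedHomogeneousComponent (fun x : V => (Pi.single x 1 : V → ℤ)) b

open Classical in
theorem weight_eq (m : V →₀ ℕ) :
    Finsupp.weight (fun x : V => (Pi.single x 1 : V → ℤ)) m = fun x => (m x : ℤ) := by
  funext y
  rw [Finsupp.weight_apply, Finsupp.sum, Finset.sum_apply]
  simp only [Pi.smul_apply, Pi.single_apply, nsmul_eq_mul, mul_ite, mul_one, mul_zero]
  rw [Finset.sum_ite_eq]
  split_ifs with h
  · rfl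
  · simp [Finsupp.notMem_support_iff.1 h]

open Classical in
theorem coeff_part (b : V → ℤ) (p : MvPolynomial V K) (m : V →₀ ℕ) :
    (part b p).coeff m = if (fun x => (m x : ℤ)) = b then p.coeff m else 0 := by
  rw [part, MvPolynomial.coeff_weightedHomogeneousComponent, weight_eq]

open Classical in
theorem isMultihomogeneous_iff (p : MvPolynomial V K) (b : V → ℤ) :
    IsMultihomogeneous p b ↔
      p ∈ MvPolynomial.weightedHomogeneousSubmodule K (fun x : V => (Pi.single x 1 : V → ℤ)) b := by
  rw [MvPolynomial.mem_weightedHomogeneousSubmodule]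
  constructor
  · intro h m hm
    rw [weight_eq]
    exact funext (h m (MvPolynomial.mem_support_iff.2 hm))
  · intro h m hm x
    have := h (MvPolynomial.mem_support_iff.1 hm)
    rw [weight_eq] at this
    exact congrFun this x

theorem part_isMultihomogeneous (b : V → ℤ) (p : MvPolynomial V K) :
    IsMultihomogeneous (part b p) b := by
  intro m hm x
  rw [MvPolynomial.mem_support_iff, coeff_part] at hm
  split_ifs at hm with h
  · exact congrFun h x
  · exact absurd rfl hm

theorem part_mul {b c : V → ℤ} (p q : MvPolynomial V K) (hq : IsMultihomogeneous q c) :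
    part (b + c) (p * q) = part b p * q := by
  classical
  rw [isMultihomogeneous_iff] at hq
  let := MvPolynomial.weightedGradedAlgebra K (fun x : V => (Pi.single x 1 : V → ℤ))
  have h := DirectSum.coe_decompose_mul_add_of_right_mem
    (MvPolynomial.weightedHomogeneousSubmodule K (fun x : V => (Pi.single x 1 : V → ℤ)))
    (a := p) (i := b) hq
  erw [MvPolynomial.weightedDecomposition.decompose'_apply,
    MvPolynomial.weightedDecomposition.decompose'_apply] at h
  exact h

/-- An element of the graded free module with basis degrees `D` is homogeneous of degree `b`. -/
def IsHom {κ : Type} (D : κ → V → ℤ) (f : κ →₀ MvPolynomial V K) (b : V → ℤ) : Prop :=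
  ∀ k, IsMultihomogeneous (f k) (b - D k)

/-- A submodule of a graded free module that is generated by homogeneous elements. -/
def IsGraded {κ : Type} (D : κ → V → ℤ)
    (N : Submodule (MvPolynomial V K) (κ →₀ MvPolynomial V K)) : Prop :=
  N = Submodule.span _ {f | f ∈ N ∧ ∃ b, IsHom D f b}

/-- The component of degree `b` of an element of a graded free module. -/
noncomputable def comp {κ : Type} [Finite κ] (D : κ → V → ℤ) (b : V → ℤ)
    (f : κ →₀ MvPolynomial V K) : κ →₀ MvPolynomial V K :=
  Finsupp.equivFunOnFinite.symm fun k => part (b - D k) (f k)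

theorem exists_sum_comp {κ : Type} [Finite κ] (D : κ → V → ℤ) (f : κ →₀ MvPolynomial V K) :
    ∃ S : Finset (V → ℤ), f = ∑ b ∈ S, comp D b f := by
  classical
  refine ⟨f.support.biUnion fun k => (f k).support.image fun m => (fun x => (m x : ℤ)) + D k, ?_⟩
  ext k m
  rw [Finsupp.finsetSum_apply, MvPolynomial.coeff_sum]
  have key : ∀ b : V → ℤ, (comp D b f k).coeff m =
      if (fun x => (m x : ℤ)) + D k = b then (f k).coeff m else 0 := by
    intro b
    change (part (b - D k) (f k)).coeff m = _
    rw [coeff_part]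
    simp only [eq_sub_iff_add_eq]
  simp only [key]
  rw [Finset.sum_ite_eq]
  split_ifs with h
  · rfl
  · by_contra hne
    apply h
    simp only [Finset.mem_biUnion, Finset.mem_image]
    refine ⟨k, ?_, m, MvPolynomial.mem_support_iff.2 hne, rfl⟩
    rw [Finsupp.mem_support_iff]
    intro h0
    rw [h0] at hne
    simp at hne

theorem linearCombination_comp {κ κ' : Type} [Finite κ'] (D : κ → V → ℤ) (D' : κ' → V → ℤ)
    (g : κ' → κ →₀ MvPolynomial V K) (hg : ∀ j, IsHom D (g j) (D' j)) (b : V → ℤ)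
    (z : κ' →₀ MvPolynomial V K) (hz : Finsupp.linearCombination (MvPolynomial V K) g z = 0) :
    Finsupp.linearCombination (MvPolynomial V K) g (comp D' b z) = 0 := by
  have := Fintype.ofFinite κ'
  rw [Finsupp.linearCombination_apply, Finsupp.sum_fintype _ _ (by simp)] at hz ⊢
  ext1 k
  have h := congrArg (fun f : κ →₀ MvPolynomial V K => part (b - D k) (f k)) hz
  simp only [Finsupp.finsetSum_apply, Finsupp.smul_apply, smul_eq_mul, map_sum, Finsupp.zero_apply,
    map_zero] at h ⊢
  rw [← h]
  refine Finset.sum_congr rfl fun j _ => ?_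
  rw [show b - D k = (b - D' j) + (D' j - D k) by abel, part_mul _ _ (hg j k)]
  rfl

theorem isGraded_ker {κ κ' : Type} [Finite κ'] (D : κ → V → ℤ) (D' : κ' → V → ℤ)
    (g : κ' → κ →₀ MvPolynomial V K) (hg : ∀ j, IsHom D (g j) (D' j)) :
    IsGraded D' (LinearMap.ker (Finsupp.linearCombination (MvPolynomial V K) g)) := by
  apply le_antisymm
  · intro z hz
    obtain ⟨S, hS⟩ := exists_sum_comp D' z
    rw [hS]
    refine Submodule.sum_mem _ fun b _ => Submodule.subset_span ⟨?_, b, ?_⟩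
    · exact linearCombination_comp D D' g hg b z hz
    · exact fun k => part_isMultihomogeneous _ _
  · exact Submodule.span_le.2 fun f hf => hf.1

/-- A graded submodule has a minimal system of homogeneous generators. -/
theorem exists_cover [Finite V] {κ : Type} [Finite κ] (D : κ → V → ℤ)
    (N : Submodule (MvPolynomial V K) (κ →₀ MvPolynomial V K)) (hN : IsGraded D N) :
    ∃ (n : ℕ) (g : Fin n → κ →₀ MvPolynomial V K) (D' : Fin n → V → ℤ),
      (∀ j, IsHom D (g j) (D' j)) ∧
      LinearMap.range (Finsupp.linearCombination (MvPolynomial V K) g) = N ∧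
      ∀ z ∈ LinearMap.ker (Finsupp.linearCombination (MvPolynomial V K) g), ∀ j,
        MvPolynomial.constantCoeff (z j) = 0 := by
  classical
  let P : ℕ → Prop := fun n => ∃ (g : Fin n → κ →₀ MvPolynomial V K) (D' : Fin n → V → ℤ),
      (∀ j, IsHom D (g j) (D' j)) ∧ Submodule.span (MvPolynomial V K) (Set.range g) = N
  have hP : ∃ n, P n := by
    have hfg : N.FG := IsNoetherian.noetherian N
    rw [hN, Submodule.fg_span_iff_fg_span_finset_subset] at hfg
    obtain ⟨s, hs, hsp⟩ := hfg
    have hs' : ∀ x : s, ∃ b, IsHom D (x : κ →₀ MvPolynomial V K) b := fun x => (hs x.2).2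
    choose δ hδ using hs'
    refine ⟨s.card, fun j => (s.equivFin.symm j : κ →₀ MvPolynomial V K),
      fun j => δ (s.equivFin.symm j), fun j => hδ _, ?_⟩
    rw [hN, hsp]
    congr 1
    ext x
    constructor
    · rintro ⟨j, rfl⟩
      exact (s.equivFin.symm j).2
    · intro hx
      exact ⟨s.equivFin ⟨x, hx⟩, by simp⟩
  obtain ⟨g, D', hg, hspan⟩ := Nat.find_spec hP
  have hmin : ∀ m, m < Nat.find hP → ¬ P m := fun m hm => Nat.find_min hP hm
  revert g D' hmin
  generalize Nat.find hP = n
  intro g D' hg hspan hmin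
  refine ⟨n, g, D', hg, by rw [Finsupp.range_linearCombination, hspan], ?_⟩
  intro z hz j
  by_contra hne
  cases n with
  | zero => exact j.elim0
  | succ n =>
    apply hmin n (Nat.lt_succ_self n)
    refine ⟨fun k => g (j.succAbove k), fun k => D' (j.succAbove k), fun k => hg _, ?_⟩
    have h0 := linearCombination_comp D D' g hg (D' j) z hz
    have hc : comp D' (D' j) z j = MvPolynomial.C (MvPolynomial.constantCoeff (z j)) := by
      change part (D' j - D' j) (z j) = _
      ext m
      rw [coeff_part, sub_self, MvPolynomial.coeff_C]
      by_cases hm : m = 0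
      · subst hm
        rw [if_pos (by funext x; simp), if_pos rfl]
        rfl
      · rw [if_neg, if_neg (Ne.symm hm)]
        intro h
        apply hm
        ext x
        have := congrFun h x
        simpa using this
    have hmem : g j ∈ Submodule.span (MvPolynomial V K)
        (Set.range fun k => g (j.succAbove k)) := by
      rw [Finsupp.linearCombination_apply, Finsupp.sum_fintype _ _ (by simp),
        Fin.sum_univ_succAbove _ j, hc] at h0
      have h1 : (MvPolynomial.C (MvPolynomial.constantCoeff (z j)) : MvPolynomial V K) • g j ∈
          Submodule.span (MvPolynomial V K) (Set.range fun k => g (j.succAbove k)) := by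
        rw [eq_neg_of_add_eq_zero_left h0]
        exact Submodule.neg_mem _ (Submodule.sum_mem _ fun k _ =>
          Submodule.smul_mem _ _ (Submodule.subset_span ⟨k, rfl⟩))
      have h2 := Submodule.smul_mem _
        (MvPolynomial.C (MvPolynomial.constantCoeff (z j))⁻¹ : MvPolynomial V K) h1
      rwa [smul_smul, ← map_mul, inv_mul_cancel₀ hne, map_one, one_smul] at h2
    rw [← hspan]
    apply le_antisymm
    · apply Submodule.span_mono
      rintro _ ⟨k, rfl⟩
      exact ⟨_, rfl⟩
    · rw [Submodule.span_le]
      rintro _ ⟨k, rfl⟩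
      rcases Fin.eq_self_or_eq_succAbove j k with rfl | ⟨k, rfl⟩
      · exact hmem
      · exact Submodule.subset_span ⟨k, rfl⟩

/-- A graded submodule of `𝔪 F` for a finite graded free module `F`. -/
structure Stage (K : Type v) [Field K] (V : Type u) where
  κ : Type
  finite_κ : Finite κ
  D : κ → V → ℤ
  N : Submodule (MvPolynomial V K) (κ →₀ MvPolynomial V K)
  graded : IsGraded D N
  minimal : ∀ f ∈ N, ∀ k, MvPolynomial.constantCoeff (f k) = 0

theorem Stage.exists_next [Finite V] (s : Stage K V) :
    ∃ (t : Stage K V) (g : t.κ → s.κ →₀ MvPolynomial V K),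
      (∀ j, IsHom s.D (g j) (t.D j)) ∧
      LinearMap.range (Finsupp.linearCombination (MvPolynomial V K) g) = s.N ∧
      LinearMap.ker (Finsupp.linearCombination (MvPolynomial V K) g) = t.N := by
  have := s.finite_κ
  obtain ⟨n, g, D', hg, hr, hm⟩ := exists_cover s.D s.N s.graded
  exact ⟨⟨Fin n, inferInstance, D', _, isGraded_ker s.D D' g hg, hm⟩, g, hg, hr, rfl⟩

/-- A homogeneous presentation `F 0 → A/I` whose kernel is a graded submodule of `𝔪 F 0` extends
to a graded minimal free resolution. -/
theorem nonempty_of_stage [Finite V] {I : Ideal (MvPolynomial V K)} (s : Stage K V)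
    (aug : (s.κ →₀ MvPolynomial V K) →ₗ[MvPolynomial V K] (MvPolynomial V K ⧸ I))
    (hgr : ∀ a, ∃ p : MvPolynomial V K, IsMultihomogeneous p (s.D a) ∧
      aug (Finsupp.single a 1) = Ideal.Quotient.mk I p)
    (hsurj : Function.Surjective aug) (hker : LinearMap.ker aug = s.N) :
    Nonempty (MinimalResolution I) := by
  choose nxt g hg hr hk using fun s : Stage K V => s.exists_next
  let seq : ℕ → Stage K V := fun i => Nat.rec s (fun _ t => nxt t) i
  refine ⟨{
    ι := fun i => (seq i).κ
    finite_ι := fun i => (seq i).finite_κ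
    deg := fun i => (seq i).D
    d := fun i => Finsupp.linearCombination (MvPolynomial V K) (g (seq i))
    aug := aug
    d_graded := ?_
    aug_graded := hgr
    aug_surjective := hsurj
    exact_zero := ?_
    exact_succ := ?_
    minimal := ?_ }⟩
  · intro i a c
    have h := hg (seq i) a c
    change IsMultihomogeneous (Finsupp.linearCombination (MvPolynomial V K) (g (seq i))
      (Finsupp.single a 1) c) _
    rw [Finsupp.linearCombination_single, one_smul]
    exact h
  · rw [LinearMap.exact_iff, hker]
    exact (hr s).symm
  · intro i
    rw [LinearMap.exact_iff]
    exact (hk (seq i)).trans (hr (seq (i + 1))).symm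
  · intro i f c
    refine (seq i).minimal _ ?_ c
    rw [← hr (seq i)]
    exact ⟨f, rfl⟩

theorem isMultihomogeneous_prod_X (e : Finset V) :
    ∃ b, IsMultihomogeneous (∏ x ∈ e, (MvPolynomial.X x : MvPolynomial V K)) b := by
  classical
  simp only [isMultihomogeneous_iff, MvPolynomial.mem_weightedHomogeneousSubmodule]
  exact ⟨_, MvPolynomial.IsWeightedHomogeneous.prod e _ _
    fun x _ => MvPolynomial.isWeightedHomogeneous_X K _ x⟩

/-- The Stanley-Reisner ring of a finite hypergraph has a multigraded minimal free resolution. -/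
theorem nonempty_minimalResolution [Finite V] (H : SimpleHypergraph V) :
    Nonempty (MinimalResolution (H.edgeIdeal K)) := by
  classical
  by_cases h0 : (∅ : Finset V) ∈ H.edges
  · have htop : H.edgeIdeal K = ⊤ := by
      rw [Ideal.eq_top_iff_one]
      exact Ideal.subset_span ⟨∅, h0, by simp⟩
    have hs : Subsingleton (MvPolynomial V K ⧸ H.edgeIdeal K) :=
      Ideal.Quotient.subsingleton_iff.2 htop
    refine nonempty_of_stage (I := H.edgeIdeal K)
      ⟨Empty, inferInstance, fun a => a.elim, ⊥, ?_, fun _ _ k => k.elim⟩ 0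
      (fun a => a.elim) (fun y => ⟨0, Subsingleton.elim _ _⟩) (Subsingleton.elim _ _)
    exact Subsingleton.elim _ _
  · let aug : (Unit →₀ MvPolynomial V K) →ₗ[MvPolynomial V K] (MvPolynomial V K ⧸ H.edgeIdeal K) :=
      (Submodule.mkQ (H.edgeIdeal K)).comp (Finsupp.lapply ())
    have hmem : ∀ f : Unit →₀ MvPolynomial V K, f ∈ LinearMap.ker aug ↔ f () ∈ H.edgeIdeal K := by
      intro f
      rw [LinearMap.mem_ker]
      exact Submodule.Quotient.mk_eq_zero _
    refine nonempty_of_stage (I := H.edgeIdeal K)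
      ⟨Unit, inferInstance, fun _ => 0, LinearMap.ker aug, ?_, ?_⟩ aug ?_ ?_ rfl
    · apply le_antisymm
      · intro f hf
        rw [hmem] at hf
        have hf' : f = Finsupp.lsingle (R := MvPolynomial V K) () (f ()) := by
          refine Finsupp.ext fun a => ?_
          simp
        rw [hf']
        have hle : H.edgeIdeal K ≤ Submodule.comap
            (Finsupp.lsingle (R := MvPolynomial V K) (M := MvPolynomial V K) ())
            (Submodule.span (MvPolynomial V K)
              {f | f ∈ LinearMap.ker aug ∧ ∃ b, IsHom (fun _ : Unit => (0 : V → ℤ)) f b}) := by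
          refine Submodule.span_le.2 ?_
          rintro _ ⟨e, he, rfl⟩
          refine Submodule.subset_span ⟨?_, ?_⟩
          · rw [hmem]
            simp only [Finsupp.lsingle_apply, Finsupp.single_eq_same]
            exact Ideal.subset_span ⟨e, he, rfl⟩
          · obtain ⟨b, hb⟩ := isMultihomogeneous_prod_X (K := K) e
            refine ⟨b, fun k => ?_⟩
            simpa using hb
        exact hle hf
      · exact Submodule.span_le.2 fun f hf => hf.1
    · intro f hf k
      rw [hmem] at hf
      have hle : H.edgeIdeal K ≤ RingHom.ker (MvPolynomial.constantCoeff (R := K) (σ := V)) := by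
        refine Ideal.span_le.2 ?_
        rintro _ ⟨e, he, rfl⟩
        have hne : e.Nonempty := by
          rw [Finset.nonempty_iff_ne_empty]
          rintro rfl
          exact h0 he
        obtain ⟨x, hx⟩ := hne
        change MvPolynomial.constantCoeff (∏ x ∈ e, MvPolynomial.X x) = 0
        rw [map_prod]
        exact Finset.prod_eq_zero hx (MvPolynomial.constantCoeff_X K x)
      exact hle hf
    · intro a
      refine ⟨1, ?_, ?_⟩
      · intro m hm x
        rw [MvPolynomial.mem_support_iff, MvPolynomial.coeff_one] at hm
        split_ifs at hm with h
        · subst h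
          simp
        · exact absurd rfl hm
      · change Submodule.mkQ _ (Finsupp.single a 1 ()) = _
        rw [Finsupp.single_eq_same]
        rfl
    · intro y
      obtain ⟨p, rfl⟩ := Submodule.mkQ_surjective _ y
      refine ⟨Finsupp.single () p, ?_⟩
      change Submodule.mkQ _ (Finsupp.single () p ()) = _
      rw [Finsupp.single_eq_same]

end Existence

/-- The multigraded Betti number `b_{i,b}` of `R = A/I_H`: the exponent of `A(-b)` in the `i`-th
module of the multigraded minimal free resolution of `R`. -/
noncomputable def multigradedBetti (K : Type v) [Field K] {V : Type u} [Finite V]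
    (H : SimpleHypergraph V) (i : ℕ) (b : V → ℤ) : ℕ :=
  (Classical.choice (nonempty_minimalResolution (K := K) H)).rank i b

end HypergraphReconstruction

-- If `b` vanishes outside a vertex set `W`, the Betti numbers in degree `b` see only `W`. In a
-- minimal resolution of `A/I_H`, keep the basis elements whose degree vanishes outside `W` and set
-- the variables outside `W` to zero. All degrees are non-negative, so this operation and the
-- inclusion back both commute with the differentials. The result is therefore a minimal resolution
-- for the hypergraph induced on `W` (`MinimalResolution.restriction`). Ranks do not depend on the
-- chosen resolution (`MinimalResolution.rank_eq`), so Betti numbers in such degrees agree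
-- (`multigradedBetti_comp_embedding`).
--
-- If `|b| < n`, some coordinate of `b` is at most zero. A negative coordinate forces all Betti
-- numbers in degree `b` to vanish; otherwise `b` has a zero `x` and is visible on the card `H - x`.
-- This is the labelled statement.
--
-- For unlabelled cards, the isomorphism of the cards at `x` and `σ x` matches the vectors vanishing
-- there, but these bijections need not fit together as `x` varies. A vector with `k` zeros appears
-- on `k` cards, so it is given weight `1/k` on each. Each bijection preserves the number of zeros,
-- and summing over the cards gives the count (`card_eq_of_deck`).

universe w

namespace HypergraphReconstruction

/-! ### Homogeneous elements and maps of graded free modules -/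

section Homogeneous

variable {K : Type v} [Field K] {V : Type u}

theorem IsMultihomogeneous.eq_zero {p : MvPolynomial V K} {b : V → ℤ}
    (hp : IsMultihomogeneous p b) {x : V} (hx : b x < 0) : p = 0 := by
  by_contra hne
  obtain ⟨m, hm⟩ := Finset.nonempty_iff_ne_empty.2 (mt MvPolynomial.support_eq_empty.1 hne)
  have := hp m hm x
  omega

theorem IsMultihomogeneous.constantCoeff_eq_zero {p : MvPolynomial V K} {b : V → ℤ}
    (hp : IsMultihomogeneous p b) (hb : b ≠ 0) : MvPolynomial.constantCoeff p = 0 := by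
  by_contra hne
  refine hb (funext fun x => ?_)
  simpa using (hp 0 (MvPolynomial.mem_support_iff.2 hne) x).symm

theorem IsMultihomogeneous.part_eq {p : MvPolynomial V K} {b : V → ℤ}
    (hp : IsMultihomogeneous p b) : part b p = p := by
  ext m
  rw [coeff_part]
  split_ifs with h
  · rfl
  · by_contra hne
    exact h (funext (hp m (MvPolynomial.mem_support_iff.2 (Ne.symm hne))))

theorem IsHom.comp_eq {κ : Type} [Finite κ] {D : κ → V → ℤ} {f : κ →₀ MvPolynomial V K} {b : V → ℤ}
    (hf : IsHom D f b) : comp D b f = f :=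
  Finsupp.ext fun k => (hf k).part_eq

theorem isHom_comp {κ : Type} [Finite κ] (D : κ → V → ℤ) (f : κ →₀ MvPolynomial V K) (b : V → ℤ) :
    IsHom D (comp D b f) b :=
  fun _ => part_isMultihomogeneous _ _

/-- A homogeneous map of graded free modules commutes with taking components. -/
theorem linearCombination_comp_eq {κ κ' : Type} [Finite κ] [Finite κ'] {D : κ → V → ℤ}
    {D' : κ' → V → ℤ} {g : κ' → κ →₀ MvPolynomial V K} (hg : ∀ j, IsHom D (g j) (D' j))
    (b : V → ℤ) (z : κ' →₀ MvPolynomial V K) :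
    Finsupp.linearCombination (MvPolynomial V K) g (comp D' b z) =
      comp D b (Finsupp.linearCombination (MvPolynomial V K) g z) := by
  have := Fintype.ofFinite κ'
  ext1 k
  change _ = part (b - D k) _
  rw [Finsupp.linearCombination_apply, Finsupp.linearCombination_apply,
    Finsupp.sum_fintype _ _ (by simp), Finsupp.sum_fintype _ _ (by simp)]
  simp only [Finsupp.finsetSum_apply, Finsupp.smul_apply, smul_eq_mul, map_sum]
  refine Finset.sum_congr rfl fun j _ => ?_
  rw [show b - D k = (b - D' j) + (D' j - D k) by abel, part_mul _ _ (hg j k)]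
  rfl

/-- A homogeneous map of graded free modules sends homogeneous elements to homogeneous elements. -/
theorem IsHom.linearCombination {κ κ' : Type} [Finite κ] [Finite κ'] {D : κ → V → ℤ}
    {D' : κ' → V → ℤ} {g : κ' → κ →₀ MvPolynomial V K} (hg : ∀ j, IsHom D (g j) (D' j))
    {b : V → ℤ} {z : κ' →₀ MvPolynomial V K} (hz : IsHom D' z b) :
    IsHom D (Finsupp.linearCombination (MvPolynomial V K) g z) b := by
  rw [← hz.comp_eq, linearCombination_comp_eq hg]
  exact isHom_comp _ _ _

/-- Puts an arbitrary linear map into the form required by the lemmas on homogeneous components. -/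
theorem eq_linearCombination {κ : Type} {M : Type*} [AddCommGroup M] [Module (MvPolynomial V K) M]
    (g : (κ →₀ MvPolynomial V K) →ₗ[MvPolynomial V K] M) :
    g = Finsupp.linearCombination (MvPolynomial V K) fun a => g (Finsupp.single a 1) := by
  ext a
  simp

/-- A linear map into a free module lifts preimages of homogeneous basis images to homogeneous
preimages. -/
theorem exists_graded_lift {κ κ₁ κ₂ : Type} [Finite κ] [Finite κ₁] [Finite κ₂] {D : κ → V → ℤ}
    {D₁ : κ₁ → V → ℤ} {D₂ : κ₂ → V → ℤ}
    {e : (κ₁ →₀ MvPolynomial V K) →ₗ[MvPolynomial V K] (κ →₀ MvPolynomial V K)}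
    {d : (κ₂ →₀ MvPolynomial V K) →ₗ[MvPolynomial V K] (κ →₀ MvPolynomial V K)}
    (he : ∀ a, IsHom D (e (Finsupp.single a 1)) (D₁ a))
    (hd : ∀ a, IsHom D (d (Finsupp.single a 1)) (D₂ a))
    (hr : ∀ f, ∃ g, e f = d g) :
    ∃ φ : (κ₁ →₀ MvPolynomial V K) →ₗ[MvPolynomial V K] (κ₂ →₀ MvPolynomial V K),
      (∀ a, IsHom D₂ (φ (Finsupp.single a 1)) (D₁ a)) ∧ ∀ f, d (φ f) = e f := by
  choose g hg using fun a => hr (Finsupp.single a 1)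
  refine ⟨Finsupp.linearCombination _ fun a => comp D₂ (D₁ a) (g a), fun a => ?_, ?_⟩
  · rw [Finsupp.linearCombination_single, one_smul]
    exact isHom_comp _ _ _
  · have : d ∘ₗ (Finsupp.linearCombination _ fun a => comp D₂ (D₁ a) (g a)) = e := by
      ext1 a
      ext1
      simp only [LinearMap.comp_apply, Finsupp.lsingle_apply, Finsupp.linearCombination_single,
        one_smul]
      conv_lhs => rw [eq_linearCombination d, linearCombination_comp_eq hd,
        ← eq_linearCombination d, ← hg a, (he a).comp_eq]
    exact fun f => LinearMap.congr_fun this f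

/-- Free modules are projective. This ungraded version serves for the homotopies, whose degrees play
no role. -/
theorem exists_lift {κ : Type} {M N : Type*} [AddCommGroup M] [Module (MvPolynomial V K) M]
    [AddCommGroup N] [Module (MvPolynomial V K) N]
    (e : (κ →₀ MvPolynomial V K) →ₗ[MvPolynomial V K] N) (d : M →ₗ[MvPolynomial V K] N)
    (hr : ∀ f, ∃ g, e f = d g) :
    ∃ h : (κ →₀ MvPolynomial V K) →ₗ[MvPolynomial V K] M, ∀ f, d (h f) = e f := by
  choose g hg using fun a => hr (Finsupp.single a 1)
  refine ⟨Finsupp.linearCombination _ g, fun f => ?_⟩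
  have : d ∘ₗ (Finsupp.linearCombination _ g) = e := by
    ext a
    simp [hg]
  exact LinearMap.congr_fun this f

/-- A linear map of finite free modules preserves the property of having all coordinates in the
ideal generated by the variables. -/
theorem constantCoeff_map_eq_zero {κ κ' : Type} [Finite κ]
    (g : (κ →₀ MvPolynomial V K) →ₗ[MvPolynomial V K] (κ' →₀ MvPolynomial V K))
    {f : κ →₀ MvPolynomial V K} (hf : ∀ k, MvPolynomial.constantCoeff (f k) = 0) (c : κ') :
    MvPolynomial.constantCoeff (g f c) = 0 := by
  have := Fintype.ofFinite κ
  rw [eq_linearCombination g, Finsupp.linearCombination_apply, Finsupp.sum_fintype _ _ (by simp),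
    Finsupp.finsetSum_apply, map_sum]
  exact Finset.sum_eq_zero fun k _ => by simp [hf]

end Homogeneous

/-! ### Non-negativity of degrees and uniqueness of the ranks -/

namespace MinimalResolution

variable {K : Type v} [Field K] {V : Type u} {I : Ideal (MvPolynomial V K)}

theorem isHom_d (F : MinimalResolution I) (i : ℕ) (a : F.ι (i + 1)) :
    IsHom (F.deg i) (F.d i (Finsupp.single a 1)) (F.deg (i + 1) a) :=
  fun c => F.d_graded i a c

theorem single_ne_d (F : MinimalResolution I) (i : ℕ) (a : F.ι i)
    (f : F.ι (i + 1) →₀ MvPolynomial V K) : F.d i f ≠ Finsupp.single a 1 := by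
  intro h
  have := F.minimal i f a
  rw [h, Finsupp.single_eq_same, map_one] at this
  exact one_ne_zero this

/-- The multidegrees of the basis elements of a minimal resolution are non-negative. -/
theorem deg_nonneg (F : MinimalResolution I) (i : ℕ) (a : F.ι i) (x : V) : 0 ≤ F.deg i a x := by
  induction i with
  | zero =>
    by_contra! hlt
    obtain ⟨p, hp, hpa⟩ := F.aug_graded a
    -- A negative degree makes the image of the basis element zero, so by exactness it is a
    -- boundary, against minimality.
    rw [hp.eq_zero hlt, map_zero] at hpa
    obtain ⟨f, hf⟩ := (F.exact_zero _).1 hpa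
    exact F.single_ne_d 0 a f hf
  | succ i ih =>
    by_contra! hlt
    have h0 : F.d i (Finsupp.single a 1) = 0 := by
      ext1 c
      refine (F.d_graded i a c).eq_zero (x := x) ?_
      have := ih c
      simp only [Pi.sub_apply]
      omega
    obtain ⟨f, hf⟩ := (F.exact_succ i _).1 h0
    exact F.single_ne_d (i + 1) a f hf

theorem rank_eq_zero (F : MinimalResolution I) (i : ℕ) {b : V → ℤ} {x : V} (hx : b x < 0) :
    F.rank i b = 0 := by
  have : IsEmpty {a : F.ι i // F.deg i a = b} :=
    ⟨fun a => absurd (F.deg_nonneg i a x) (by rw [a.2]; omega)⟩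
  exact Nat.card_of_isEmpty

/-- If `I` is a graded ideal, the basis of degree zero of a resolution lifts to any other
resolution. -/
theorem exists_graded_lift_zero (hI : ∀ p ∈ I, ∀ b, part b p ∈ I) (F G : MinimalResolution I) :
    ∃ φ : (F.ι 0 →₀ MvPolynomial V K) →ₗ[MvPolynomial V K] (G.ι 0 →₀ MvPolynomial V K),
      (∀ a, IsHom (G.deg 0) (φ (Finsupp.single a 1)) (F.deg 0 a)) ∧ ∀ f, G.aug (φ f) = F.aug f := by
  have := G.finite_ι 0
  have := Fintype.ofFinite (G.ι 0)
  choose p hp hpa using F.aug_graded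
  choose q hq hqa using G.aug_graded
  have key : ∀ g : G.ι 0 →₀ MvPolynomial V K,
      G.aug g = Ideal.Quotient.mk I (∑ c, g c * q c) := by
    intro g
    conv_lhs => rw [eq_linearCombination G.aug]
    rw [Finsupp.linearCombination_apply, Finsupp.sum_fintype _ _ (by simp), map_sum]
    refine Finset.sum_congr rfl fun c _ => ?_
    rw [hqa, map_mul]
    rfl
  choose g hg using fun a => G.aug_surjective (F.aug (Finsupp.single a 1))
  refine ⟨Finsupp.linearCombination _ fun a => comp (G.deg 0) (F.deg 0 a) (g a), fun a => ?_, ?_⟩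
  · rw [Finsupp.linearCombination_single, one_smul]
    exact isHom_comp _ _ _
  · have : G.aug ∘ₗ (Finsupp.linearCombination _ fun a => comp (G.deg 0) (F.deg 0 a) (g a)) =
        F.aug := by
      ext1 a
      ext1
      simp only [LinearMap.comp_apply, Finsupp.lsingle_apply, Finsupp.linearCombination_single,
        one_smul]
      have h := hg a
      rw [key, hpa, Ideal.Quotient.mk_eq_mk_iff_sub_mem] at h
      rw [key, hpa, Ideal.Quotient.mk_eq_mk_iff_sub_mem]
      -- The relation for the homogeneous component of `g a` is the degree `F.deg 0 a` part of the
      -- relation `h`.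
      convert hI _ h (F.deg 0 a) using 1
      rw [map_sub, (hp a).part_eq, map_sum]
      congr 1
      refine Finset.sum_congr rfl fun c _ => ?_
      have := part_mul (b := F.deg 0 a - G.deg 0 c) (g a c) (q c) (hq c)
      rw [sub_add_cancel] at this
      exact this.symm
    exact fun f => LinearMap.congr_fun this f

/-- Mutually inverse (modulo the variables) homogeneous maps between the `i`-th modules of two
resolutions, liftable to the next step, where they are homotopic to the identity. -/
theorem exists_comparison (hI : ∀ p ∈ I, ∀ b, part b p ∈ I) (F G : MinimalResolution I) (i : ℕ) :
    ∃ (φ : (F.ι i →₀ MvPolynomial V K) →ₗ[MvPolynomial V K] (G.ι i →₀ MvPolynomial V K))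
      (ψ : (G.ι i →₀ MvPolynomial V K) →ₗ[MvPolynomial V K] (F.ι i →₀ MvPolynomial V K))
      (h : (F.ι i →₀ MvPolynomial V K) →ₗ[MvPolynomial V K] (F.ι (i + 1) →₀ MvPolynomial V K))
      (k : (G.ι i →₀ MvPolynomial V K) →ₗ[MvPolynomial V K] (G.ι (i + 1) →₀ MvPolynomial V K)),
      (∀ a, IsHom (G.deg i) (φ (Finsupp.single a 1)) (F.deg i a)) ∧
      (∀ a, IsHom (F.deg i) (ψ (Finsupp.single a 1)) (G.deg i a)) ∧
      (∀ f, ∃ g, φ (F.d i f) = G.d i g) ∧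
      (∀ f, ∃ g, ψ (G.d i f) = F.d i g) ∧
      (∀ f, ψ (φ (F.d i f)) - F.d i f = F.d i (h (F.d i f))) ∧
      (∀ f, φ (ψ (G.d i f)) - G.d i f = G.d i (k (G.d i f))) ∧
      (∀ f a, MvPolynomial.constantCoeff ((ψ (φ f) - f) a) = 0) ∧
      (∀ f a, MvPolynomial.constantCoeff ((φ (ψ f) - f) a) = 0) := by
  have hFf := F.finite_ι
  have hGf := G.finite_ι
  -- The homotopy identity is required only on the image of `d i`: there the term `h ∘ d` from one
  -- step lower vanishes, so step zero has the same form as the others.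
  induction i with
  | zero =>
    obtain ⟨φ, hφ, hφa⟩ := exists_graded_lift_zero hI F G
    obtain ⟨ψ, hψ, hψa⟩ := exists_graded_lift_zero hI G F
    obtain ⟨h, hh⟩ := exists_lift (ψ ∘ₗ φ - LinearMap.id) (F.d 0) fun f => by
      obtain ⟨g, hg⟩ := (F.exact_zero (ψ (φ f) - f)).1 (by simp [hφa, hψa])
      exact ⟨g, hg.symm⟩
    obtain ⟨k, hk⟩ := exists_lift (φ ∘ₗ ψ - LinearMap.id) (G.d 0) fun f => by
      obtain ⟨g, hg⟩ := (G.exact_zero (φ (ψ f) - f)).1 (by simp [hφa, hψa])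
      exact ⟨g, hg.symm⟩
    refine ⟨φ, ψ, h, k, hφ, hψ, fun f => ?_, fun f => ?_, fun f => (hh _).symm,
      fun f => (hk _).symm, fun f a => ?_, fun f a => ?_⟩
    · obtain ⟨g, hg⟩ := (G.exact_zero (φ (F.d 0 f))).1
        (by rw [hφa]; exact F.exact_zero.apply_apply_eq_zero f)
      exact ⟨g, hg.symm⟩
    · obtain ⟨g, hg⟩ := (F.exact_zero (ψ (G.d 0 f))).1
        (by rw [hψa]; exact G.exact_zero.apply_apply_eq_zero f)
      exact ⟨g, hg.symm⟩
    · have := F.minimal 0 (h f) a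
      rwa [hh] at this
    · have := G.minimal 0 (k f) a
      rwa [hk] at this
  | succ i ih =>
    obtain ⟨φ, ψ, h, k, hφ, hψ, hφr, hψr, hh, hk, -, -⟩ := ih
    have hFF : ∀ f, F.d i (F.d (i + 1) f) = 0 := (F.exact_succ i).apply_apply_eq_zero
    have hGG : ∀ f, G.d i (G.d (i + 1) f) = 0 := (G.exact_succ i).apply_apply_eq_zero
    obtain ⟨φ', hφ', hφc⟩ := exists_graded_lift (e := φ ∘ₗ F.d i) (d := G.d i)
      (fun a => by
        rw [LinearMap.comp_apply, eq_linearCombination φ]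
        exact IsHom.linearCombination hφ (F.isHom_d i a))
      (G.isHom_d i) hφr
    obtain ⟨ψ', hψ', hψc⟩ := exists_graded_lift (e := ψ ∘ₗ G.d i) (d := F.d i)
      (fun a => by
        rw [LinearMap.comp_apply, eq_linearCombination ψ]
        exact IsHom.linearCombination hψ (G.isHom_d i a))
      (F.isHom_d i) hψr
    simp only [LinearMap.comp_apply] at hφc hψc
    -- The usual construction of a chain homotopy: by the inductive identity this map lands in the
    -- kernel of `F.d i`.
    obtain ⟨h', hh'⟩ := exists_lift (ψ' ∘ₗ φ' - LinearMap.id - h ∘ₗ F.d i) (F.d (i + 1))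
      fun f => by
        obtain ⟨g, hg⟩ := (F.exact_succ i (ψ' (φ' f) - f - h (F.d i f))).1 (by
          simp [hψc, hφc, hh])
        exact ⟨g, hg.symm⟩
    obtain ⟨k', hk'⟩ := exists_lift (φ' ∘ₗ ψ' - LinearMap.id - k ∘ₗ G.d i) (G.d (i + 1))
      fun f => by
        obtain ⟨g, hg⟩ := (G.exact_succ i (φ' (ψ' f) - f - k (G.d i f))).1 (by
          simp [hψc, hφc, hk])
        exact ⟨g, hg.symm⟩
    simp only [LinearMap.sub_apply, LinearMap.comp_apply, LinearMap.id_apply] at hh' hk'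
    refine ⟨φ', ψ', h', k', hφ', hψ', fun f => ?_, fun f => ?_, fun f => ?_,
      fun f => ?_, fun f a => ?_, fun f a => ?_⟩
    · obtain ⟨g, hg⟩ := (G.exact_succ i (φ' (F.d (i + 1) f))).1 (by rw [hφc, hFF, map_zero])
      exact ⟨g, hg.symm⟩
    · obtain ⟨g, hg⟩ := (F.exact_succ i (ψ' (G.d (i + 1) f))).1 (by rw [hψc, hGG, map_zero])
      exact ⟨g, hg.symm⟩
    · rw [hh', hFF, map_zero, sub_zero]
    · rw [hk', hGG, map_zero, sub_zero]
    -- Here `ψ' φ' - id = d h' + h d`, and both terms vanish modulo the variables by minimality.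
    · rw [eq_add_of_sub_eq (hh' f).symm, Finsupp.add_apply, map_add, F.minimal, zero_add]
      exact constantCoeff_map_eq_zero h (F.minimal i f) a
    · rw [eq_add_of_sub_eq (hk' f).symm, Finsupp.add_apply, map_add, G.minimal, zero_add]
      exact constantCoeff_map_eq_zero k (G.minimal i f) a

/-- If a homogeneous map of finite graded free modules has a left inverse modulo the variables, then
in each degree the number of basis elements does not decrease. -/
theorem card_degree_le {κ κ' : Type} [Finite κ] [Finite κ'] {D : κ → V → ℤ} {D' : κ' → V → ℤ}
    (φ : (κ →₀ MvPolynomial V K) →ₗ[MvPolynomial V K] (κ' →₀ MvPolynomial V K))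
    (ψ : (κ' →₀ MvPolynomial V K) →ₗ[MvPolynomial V K] (κ →₀ MvPolynomial V K))
    (hφ : ∀ a, IsHom D' (φ (Finsupp.single a 1)) (D a))
    (h : ∀ f a, MvPolynomial.constantCoeff ((ψ (φ f) - f) a) = 0) (b : V → ℤ) :
    Nat.card {a // D a = b} ≤ Nat.card {c // D' c = b} := by
  classical
  have := Fintype.ofFinite κ
  have := Fintype.ofFinite κ'
  -- `M` and `N` are the degree `b` blocks of `φ` and `ψ` modulo the variables.
  let M : Matrix {a // D a = b} {c // D' c = b} K :=
    Matrix.of fun a c => MvPolynomial.constantCoeff (φ (Finsupp.single a.1 1) c.1)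
  let N : Matrix {c // D' c = b} {a // D a = b} K :=
    Matrix.of fun c a => MvPolynomial.constantCoeff (ψ (Finsupp.single c.1 1) a.1)
  have hMN : M * N = 1 := by
    ext a a'
    have h1 := h (Finsupp.single a.1 1) a'.1
    rw [eq_linearCombination ψ, Finsupp.sub_apply, map_sub, sub_eq_zero,
      Finsupp.linearCombination_apply, Finsupp.sum_fintype _ _ (by simp), Finsupp.finsetSum_apply,
      map_sum] at h1
    simp only [Finsupp.smul_apply, smul_eq_mul, map_mul] at h1
    have h2 : MvPolynomial.constantCoeff ((Finsupp.single a.1 (1 : MvPolynomial V K)) a'.1) =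
        if a = a' then (1 : K) else 0 := by
      rw [Finsupp.single_apply]
      simp only [Subtype.ext_iff]
      split_ifs <;> simp
    rw [Matrix.mul_apply, Matrix.one_apply, ← h2, ← h1]
    simp only [M, N, Matrix.of_apply]
    rw [← Finset.sum_subtype (F := inferInstance) (p := fun c => D' c = b)
      (Finset.univ.filter fun c => D' c = b) (by simp)
      fun c => MvPolynomial.constantCoeff (φ (Finsupp.single a.1 1) c) *
        MvPolynomial.constantCoeff (ψ (Finsupp.single c 1) a'.1)]
    -- A basis element `c` of another degree contributes nothing: its coefficient has non-zero
    -- multidegree, hence no constant term.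
    refine Finset.sum_subset (Finset.filter_subset _ _) fun c _ hc => ?_
    rw [(hφ a.1 c).constantCoeff_eq_zero, zero_mul]
    rw [a.2]
    exact fun h0 => hc (by simp [sub_eq_zero.1 h0])
  rw [Nat.card_eq_fintype_card, Nat.card_eq_fintype_card, ← Matrix.rank_one (R := K), ← hMN]
  exact (Matrix.rank_mul_le_left M N).trans M.rank_le_card_width

/-- The ranks of a minimal resolution do not depend on the resolution. -/
theorem rank_eq (hI : ∀ p ∈ I, ∀ b, part b p ∈ I) (F G : MinimalResolution I) (i : ℕ) (b : V → ℤ) :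
    F.rank i b = G.rank i b := by
  have := F.finite_ι i
  have := G.finite_ι i
  obtain ⟨φ, ψ, -, -, hφ, hψ, -, -, -, -, h, k⟩ := exists_comparison hI F G i
  exact le_antisymm (card_degree_le φ ψ hφ h b) (card_degree_le ψ φ hψ k b)

end MinimalResolution

/-! ### Setting variables to zero and extending back -/

section Restriction

variable {K : Type v} [Field K] {V : Type u} {W : Type w}

theorem IsMultihomogeneous.killCompl {f : W → V} (hf : f.Injective) {p : MvPolynomial V K}
    {b : V → ℤ} (hp : IsMultihomogeneous p b) :
    IsMultihomogeneous (MvPolynomial.killCompl hf p) fun x => b (f x) := by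
  intro m hm x
  rw [MvPolynomial.mem_support_iff, MvPolynomial.coeff_killCompl] at hm
  have := hp _ (MvPolynomial.mem_support_iff.2 hm) (f x)
  rwa [Finsupp.mapDomain_apply hf] at this

theorem IsMultihomogeneous.killCompl_eq_zero {f : W → V} (hf : f.Injective) {p : MvPolynomial V K}
    {b : V → ℤ} (hp : IsMultihomogeneous p b) {x : V} (hx : x ∉ Set.range f) (hb : b x ≠ 0) :
    MvPolynomial.killCompl hf p = 0 := by
  ext m
  rw [MvPolynomial.coeff_killCompl, MvPolynomial.coeff_zero]
  by_contra hne
  refine hb ?_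
  rw [← hp _ (MvPolynomial.mem_support_iff.2 hne) x, Finsupp.mapDomain_of_notMem_range _ _ hx,
    Nat.cast_zero]

theorem IsMultihomogeneous.rename_killCompl {f : W → V} (hf : f.Injective) {p : MvPolynomial V K}
    {b : V → ℤ} (hp : IsMultihomogeneous p b) (hb : ∀ x ∉ Set.range f, b x = 0) :
    MvPolynomial.rename f (MvPolynomial.killCompl hf p) = p := by
  ext m
  by_cases hm : ∃ m' : W →₀ ℕ, m'.mapDomain f = m
  · obtain ⟨m', rfl⟩ := hm
    rw [MvPolynomial.coeff_rename_mapDomain f hf, MvPolynomial.coeff_killCompl]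
  · rw [MvPolynomial.coeff_rename_eq_zero _ _ _ fun u hu => absurd ⟨u, hu⟩ hm]
    by_contra hne
    refine hm ⟨_, Finsupp.mapDomain_comapDomain f hf m fun x hx => ?_⟩
    by_contra hr
    have := hp m (MvPolynomial.mem_support_iff.2 (Ne.symm hne)) x
    rw [hb x hr] at this
    simp only [Finset.mem_coe, Finsupp.mem_support_iff] at hx
    omega

theorem constantCoeff_killCompl {f : W → V} (hf : f.Injective) (p : MvPolynomial V K) :
    MvPolynomial.constantCoeff (MvPolynomial.killCompl hf p) = MvPolynomial.constantCoeff p := by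
  change (MvPolynomial.killCompl hf p).coeff 0 = p.coeff 0
  rw [MvPolynomial.coeff_killCompl, Finsupp.mapDomain_zero]

/-- Forget the coordinates outside `s` and set the variables outside the range of `f` to zero. -/
noncomputable def restrict {f : W → V} (hf : f.Injective) {κ : Type} (s : κ → Prop) :
    (κ →₀ MvPolynomial V K) →+ ({a // s a} →₀ MvPolynomial W K) :=
  (Finsupp.subtypeDomainAddMonoidHom (p := s)).comp
    (Finsupp.mapRange.addMonoidHom (MvPolynomial.killCompl hf : _ →ₐ[K] _).toAddMonoidHom)

/-- Extend by zero along the inclusion of `s` and rename the variables along `f`. -/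
noncomputable def extend (f : W → V) {κ : Type} (s : κ → Prop) :
    ({a // s a} →₀ MvPolynomial W K) →+ (κ →₀ MvPolynomial V K) :=
  (Finsupp.mapDomain.addMonoidHom Subtype.val).comp
    (Finsupp.mapRange.addMonoidHom (MvPolynomial.rename f : _ →ₐ[K] _).toAddMonoidHom)

variable {f : W → V} (hf : f.Injective) {κ : Type} (s : κ → Prop)

@[simp]
theorem restrict_apply (g : κ →₀ MvPolynomial V K) (a : {a // s a}) :
    restrict hf s g a = MvPolynomial.killCompl hf (g a) := rfl

theorem restrict_smul (p : MvPolynomial V K) (g : κ →₀ MvPolynomial V K) :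
    restrict hf s (p • g) = MvPolynomial.killCompl hf p • restrict hf s g := by
  ext1 a
  simp

theorem extend_apply_coe (g : {a // s a} →₀ MvPolynomial W K) (a : {a // s a}) :
    extend (K := K) f s g a = MvPolynomial.rename f (g a) := by
  change Finsupp.mapDomain _ _ _ = _
  rw [Finsupp.mapDomain_apply Subtype.val_injective]
  rfl

theorem extend_apply_of_not (g : {a // s a} →₀ MvPolynomial W K) {a : κ} (ha : ¬ s a) :
    extend (K := K) f s g a = 0 := by
  change Finsupp.mapDomain _ _ _ = _
  rw [Finsupp.mapDomain_of_notMem_range]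
  simpa using ha

theorem extend_smul (p : MvPolynomial W K) (g : {a // s a} →₀ MvPolynomial W K) :
    extend (K := K) f s (p • g) = MvPolynomial.rename f p • extend f s g := by
  ext1 a
  by_cases ha : s a
  · have h1 := extend_apply_coe (f := f) s (p • g) ⟨a, ha⟩
    have h2 := extend_apply_coe (f := f) s g ⟨a, ha⟩
    simp_all
  · simp [extend_apply_of_not s _ ha]

@[simp]
theorem restrict_extend (g : {a // s a} →₀ MvPolynomial W K) :
    restrict hf s (extend f s g) = g := by
  ext1 a
  rw [restrict_apply, extend_apply_coe, MvPolynomial.killCompl_rename_app]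

theorem restrict_single (a : {a // s a}) (p : MvPolynomial V K) :
    restrict hf s (Finsupp.single a.1 p) = Finsupp.single a (MvPolynomial.killCompl hf p) := by
  classical
  ext1 c
  rw [restrict_apply, Finsupp.single_apply, Finsupp.single_apply]
  simp only [Subtype.ext_iff]
  split_ifs <;> simp

theorem restrict_single_of_not {a : κ} (ha : ¬ s a) (p : MvPolynomial V K) :
    restrict hf s (Finsupp.single a p) = 0 := by
  classical
  ext1 c
  rw [restrict_apply, Finsupp.single_eq_of_ne, map_zero, Finsupp.zero_apply]
  rintro h
  exact ha (h ▸ c.2)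

theorem extend_single (a : {a // s a}) (p : MvPolynomial W K) :
    extend (K := K) f s (Finsupp.single a p) = Finsupp.single a.1 (MvPolynomial.rename f p) := by
  simp [extend]

/-- The map `restrict` followed by `extend` is the identity on homogeneous elements of a degree
that vanishes outside the range of `f`, if `s` is the set of basis elements of such degrees. -/
theorem extend_restrict {D : κ → V → ℤ} (hD : ∀ a x, 0 ≤ D a x)
    {g : κ →₀ MvPolynomial V K} {b : V → ℤ} (hg : IsHom D g b) (hb : ∀ x ∉ Set.range f, b x = 0) :
    extend f (fun a => ∀ x ∉ Set.range f, D a x = 0)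
      (restrict hf (fun a => ∀ x ∉ Set.range f, D a x = 0) g) = g := by
  ext1 a
  by_cases ha : ∀ x ∉ Set.range f, D a x = 0
  · refine (extend_apply_coe (f := f) (fun a => ∀ x ∉ Set.range f, D a x = 0) _ ⟨a, ha⟩).trans ?_
    rw [restrict_apply]
    refine (hg a).rename_killCompl hf fun x hx => ?_
    rw [Pi.sub_apply, hb x hx, ha x hx, sub_zero]
  · rw [extend_apply_of_not (fun a => ∀ x ∉ Set.range f, D a x = 0) _ ha]
    push Not at ha
    obtain ⟨x, hx, hne⟩ := ha
    -- Since `D a x > 0 = b x`, this coefficient has negative degree at `x`.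
    refine ((hg a).eq_zero (x := x) ?_).symm
    have := hD a x
    rw [Pi.sub_apply, hb x hx]
    omega

end Restriction

/-! ### The restricted resolution -/

namespace MinimalResolution

variable {K : Type v} [Field K] {V : Type u} {W : Type w} {I : Ideal (MvPolynomial V K)}
  {I' : Ideal (MvPolynomial W K)} (F : MinimalResolution I) {f : W → V} (hf : f.Injective)

theorem smul_quotient_eq (p : MvPolynomial V K) (y : MvPolynomial V K ⧸ I) :
    p • y = Ideal.Quotient.mk I p * y := by
  obtain ⟨q, rfl⟩ := Ideal.Quotient.mk_surjective y
  rfl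

/-- The basis elements whose degree vanishes outside the range of `f`. -/
def Supported (f : W → V) (i : ℕ) (a : F.ι i) : Prop :=
  ∀ x ∉ Set.range f, F.deg i a x = 0

/-- The restricted differential. -/
noncomputable def restrictD (i : ℕ) :
    ({a // F.Supported f (i + 1) a} →₀ MvPolynomial W K) →ₗ[MvPolynomial W K]
      ({a // F.Supported f i a} →₀ MvPolynomial W K) :=
  Finsupp.linearCombination _ fun a => restrict hf _ (F.d i (Finsupp.single a.1 1))

/-- The differential of a supported basis element involves only supported basis elements and
variables in the range of `f`, so restricting it loses nothing. -/
theorem d_extend (i : ℕ) (g : {a // F.Supported f (i + 1) a} →₀ MvPolynomial W K) :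
    F.d i (extend f _ g) = extend f _ (F.restrictD hf i g) := by
  induction g using Finsupp.induction_linear with
  | zero => simp
  | add g₁ g₂ h₁ h₂ => simp [h₁, h₂]
  | single a p =>
    rw [extend_single, restrictD, Finsupp.linearCombination_single, extend_smul]
    have h := extend_restrict hf (F.deg_nonneg i) (F.isHom_d i a.1) a.2
    refine Eq.trans ?_ (congrArg _ h.symm)
    rw [← map_smul, Finsupp.smul_single_one]

/-- An unsupported basis element must have differential restricting to zero: its coefficients at
supported elements all involve a variable outside the range of `f`. -/
theorem restrict_d (i : ℕ) (g : F.ι (i + 1) →₀ MvPolynomial V K) :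
    restrict hf (F.Supported f i) (F.d i g) = F.restrictD hf i (restrict hf _ g) := by
  induction g using Finsupp.induction_linear with
  | zero => simp
  | add g₁ g₂ h₁ h₂ => simp [h₁, h₂]
  | single a p =>
    rw [← Finsupp.smul_single_one, map_smul, restrict_smul, Finsupp.smul_single_one]
    by_cases ha : F.Supported f (i + 1) a
    · rw [restrict_single hf _ ⟨a, ha⟩, restrictD, Finsupp.linearCombination_single]
    · rw [restrict_single_of_not hf _ ha, map_zero]
      have : restrict hf (F.Supported f i) (F.d i (Finsupp.single a 1)) = 0 := by
        rw [Supported] at ha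
        push Not at ha
        obtain ⟨x, hx, hne⟩ := ha
        ext1 c
        refine (F.d_graded i a c.1).killCompl_eq_zero hf hx ?_
        rwa [Pi.sub_apply, c.2 x hx, sub_zero]
      rw [this, smul_zero]

/-- The restriction of a minimal resolution of `A/I` to the degrees that vanish outside the range
of `f`, which is a minimal resolution over the polynomial ring in the remaining variables. -/
noncomputable def restriction (hj : I' ≤ I.comap (MvPolynomial.rename f : _ →ₐ[K] _).toRingHom)
    (hπ : I ≤ I'.comap (MvPolynomial.killCompl hf : _ →ₐ[K] _).toRingHom) :
    MinimalResolution I' :=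
  let π := Ideal.quotientMap I' (MvPolynomial.killCompl hf : _ →ₐ[K] _).toRingHom hπ
  let j := Ideal.quotientMap I (MvPolynomial.rename f : _ →ₐ[K] _).toRingHom hj
  have hπj : ∀ y, π (j y) = y := by
    intro y
    obtain ⟨p, rfl⟩ := Ideal.Quotient.mk_surjective y
    simp [π, j, MvPolynomial.killCompl_rename_app]
  let aug' : ({a // F.Supported f 0 a} →₀ MvPolynomial W K) →ₗ[MvPolynomial W K]
      (MvPolynomial W K ⧸ I') :=
    Finsupp.linearCombination _ fun a => π (F.aug (Finsupp.single a.1 1))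
  have aug_extend : ∀ g, F.aug (extend f _ g) = j (aug' g) := by
    intro g
    induction g using Finsupp.induction_linear with
    | zero => simp
    | add g₁ g₂ h₁ h₂ => simp [h₁, h₂]
    | single a p =>
      obtain ⟨q, hq, hqa⟩ := F.aug_graded a.1
      simp only [aug']
      rw [extend_single, Finsupp.linearCombination_single, ← Finsupp.smul_single_one, map_smul, hqa,
        smul_quotient_eq, smul_quotient_eq, map_mul]
      congr 1
      simp only [π, j, Ideal.quotientMap_mk]
      exact congrArg _ (hq.rename_killCompl hf a.2).symm
  have restrict_aug : ∀ g, π (F.aug g) = aug' (restrict hf _ g) := by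
    intro g
    induction g using Finsupp.induction_linear with
    | zero => simp
    | add g₁ g₂ h₁ h₂ => simp [h₁, h₂]
    | single a p =>
      obtain ⟨q, hq, hqa⟩ := F.aug_graded a
      rw [← Finsupp.smul_single_one, map_smul, smul_quotient_eq, map_mul, Finsupp.smul_single_one]
      by_cases ha : F.Supported f 0 a
      · rw [restrict_single hf _ ⟨a, ha⟩]
        simp only [aug']
        rw [Finsupp.linearCombination_single, smul_quotient_eq]
        rfl
      · rw [restrict_single_of_not hf _ ha, map_zero, hqa]
        rw [Supported] at ha
        push Not at ha
        obtain ⟨x, hx, hne⟩ := ha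
        have : π (Ideal.Quotient.mk I q) = 0 := by
          simp only [π, Ideal.quotientMap_mk]
          refine (congrArg _ (hq.killCompl_eq_zero hf hx hne)).trans (map_zero _)
        rw [this, mul_zero]
  { ι := fun i => {a // F.Supported f i a}
    finite_ι := fun i => have := F.finite_ι i; inferInstance
    deg := fun i a x => F.deg i a.1 (f x)
    d := F.restrictD hf
    aug := aug'
    d_graded := by
      intro i a c
      rw [restrictD, Finsupp.linearCombination_single, one_smul]
      exact (F.d_graded i a.1 c.1).killCompl hf
    aug_graded := by
      intro a
      obtain ⟨q, hq, hqa⟩ := F.aug_graded a.1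
      refine ⟨_, hq.killCompl hf, ?_⟩
      simp only [aug', Finsupp.linearCombination_single, one_smul, hqa]
      rfl
    aug_surjective := by
      intro y
      obtain ⟨g, hg⟩ := F.aug_surjective (j y)
      exact ⟨restrict hf _ g, by rw [← restrict_aug, hg, hπj]⟩
    exact_zero := by
      intro g
      constructor
      · intro hg
        -- Exactness descends because the restricted complex is a retract of `F`: extend the cycle,
        -- bound it in `F`, restrict the bounding element.
        obtain ⟨k, hk⟩ := (F.exact_zero (extend f _ g)).1 (by rw [aug_extend, hg, map_zero])
        exact ⟨restrict hf _ k, by rw [← restrict_d, hk, restrict_extend]⟩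
      · rintro ⟨k, rfl⟩
        rw [← restrict_extend hf _ k, ← restrict_d, ← restrict_aug,
          F.exact_zero.apply_apply_eq_zero, map_zero]
    exact_succ := by
      intro i g
      constructor
      · intro hg
        obtain ⟨k, hk⟩ := (F.exact_succ i (extend f _ g)).1 (by rw [F.d_extend hf, hg, map_zero])
        exact ⟨restrict hf _ k, by rw [← restrict_d, hk, restrict_extend]⟩
      · rintro ⟨k, rfl⟩
        rw [← restrict_extend hf _ k, ← restrict_d, ← restrict_d,
          (F.exact_succ i).apply_apply_eq_zero, map_zero]
    minimal := by
      intro i g c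
      rw [← restrict_extend hf _ g, ← restrict_d, restrict_apply, constantCoeff_killCompl,
        F.minimal] }

theorem rank_restriction (hj : I' ≤ I.comap (MvPolynomial.rename f : _ →ₐ[K] _).toRingHom)
    (hπ : I ≤ I'.comap (MvPolynomial.killCompl hf : _ →ₐ[K] _).toRingHom) (i : ℕ) {b : V → ℤ}
    (hb : ∀ x ∉ Set.range f, b x = 0) :
    (F.restriction hf hj hπ).rank i (fun x => b (f x)) = F.rank i b := by
  refine Nat.card_congr
    { toFun := fun a => ⟨a.1.1, funext fun x => ?_⟩
      invFun := fun a => ⟨⟨a.1, fun x hx => by rw [a.2, hb x hx]⟩, funext fun x => congrFun a.2 _⟩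
      left_inv := fun a => rfl
      right_inv := fun a => rfl }
  by_cases hx : x ∈ Set.range f
  · obtain ⟨y, rfl⟩ := hx
    exact congrFun a.2 y
  · rw [a.1.2 x hx, hb x hx]

end MinimalResolution

/-! ### Betti numbers of induced hypergraphs -/

section EdgeIdeal

variable {K : Type v} [Field K] {V : Type u} {W : Type w}

open Classical in
theorem mem_edgeIdeal_iff (H : SimpleHypergraph V) (p : MvPolynomial V K) :
    p ∈ H.edgeIdeal K ↔
      ∀ m ∈ p.support, ∃ e ∈ H.edges, (∑ x ∈ e, Finsupp.single x 1 : V →₀ ℕ) ≤ m := by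
  have : H.edgeIdeal K = Ideal.span ((fun m : V →₀ ℕ => MvPolynomial.monomial m (1 : K)) ''
      ((fun e : Finset V => ∑ x ∈ e, Finsupp.single x 1) '' H.edges)) := by
    rw [Set.image_image, SimpleHypergraph.edgeIdeal]
    simp only [MvPolynomial.monomial_sum_one]
    rfl
  rw [this, MvPolynomial.mem_ideal_span_monomial_image]
  simp only [Set.exists_mem_image]

theorem part_mem_edgeIdeal (H : SimpleHypergraph V) {p : MvPolynomial V K} (hp : p ∈ H.edgeIdeal K)
    (b : V → ℤ) : part b p ∈ H.edgeIdeal K := by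
  rw [mem_edgeIdeal_iff] at *
  intro m hm
  refine hp m ?_
  rw [MvPolynomial.mem_support_iff, coeff_part] at *
  split_ifs at hm
  · exact hm
  · exact absurd rfl hm

/-- Frees the Betti numbers from the resolution chosen in their definition. Uniqueness applies
because a monomial ideal is graded. -/
theorem multigradedBetti_eq_rank [Finite V] (H : SimpleHypergraph V)
    (F : MinimalResolution (H.edgeIdeal K)) (i : ℕ) (b : V → ℤ) :
    multigradedBetti K H i b = F.rank i b :=
  MinimalResolution.rank_eq (fun _ hp b => part_mem_edgeIdeal H hp b) _ F i b

theorem multigradedBetti_eq_zero [Finite V] (H : SimpleHypergraph V) (i : ℕ) {b : V → ℤ} {x : V}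
    (hx : b x < 0) : multigradedBetti K H i b = 0 :=
  MinimalResolution.rank_eq_zero _ i hx

/-- The multigraded Betti numbers in degrees that vanish outside the range of an embedding are
those of the induced hypergraph. -/
theorem multigradedBetti_comp_embedding [Finite V] [Finite W] (f : W ↪ V) (H : SimpleHypergraph V)
    (H' : SimpleHypergraph W) (hH : ∀ e : Finset W, e.map f ∈ H.edges ↔ e ∈ H'.edges) (i : ℕ)
    {b : V → ℤ} (hb : ∀ x ∉ Set.range f, b x = 0) :
    multigradedBetti K H' i (fun x => b (f x)) = multigradedBetti K H i b := by
  classical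
  rw [multigradedBetti_eq_rank H' (MinimalResolution.restriction
    (Classical.choice (nonempty_minimalResolution H)) f.injective ?_ ?_)]
  · exact MinimalResolution.rank_restriction _ f.injective _ _ i hb
  · refine Ideal.span_le.2 ?_
    rintro _ ⟨e, he, rfl⟩
    refine Ideal.subset_span ⟨e.map f, (hH e).2 he, ?_⟩
    simp
  · refine Ideal.span_le.2 ?_
    rintro _ ⟨e, he, rfl⟩
    simp only [SetLike.mem_coe, Ideal.mem_comap]
    -- An edge inside the range comes from an edge of `H'`; the monomial of any other edge contains
    -- a variable that is set to zero.
    by_cases hr : (e : Set V) ⊆ Set.range f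
    · obtain ⟨e, rfl⟩ : ∃ e' : Finset W, e'.map f = e :=
        ⟨e.preimage f f.injective.injOn, by
          ext x
          simp only [Finset.mem_map, Finset.mem_preimage]
          exact ⟨by rintro ⟨y, hy, rfl⟩; exact hy,
            fun hx => by obtain ⟨y, rfl⟩ := hr hx; exact ⟨y, hx, rfl⟩⟩⟩
      refine Ideal.subset_span ⟨e, (hH e).1 he, ?_⟩
      have hren : MvPolynomial.rename f (∏ x ∈ e, (MvPolynomial.X x : MvPolynomial W K)) =
          ∏ x ∈ e.map f, MvPolynomial.X x := by simp
      exact (MvPolynomial.killCompl_rename_app f.injective _).symm.trans (congrArg _ hren)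
    · obtain ⟨x, hx, hxr⟩ := Set.not_subset.1 hr
      have : MvPolynomial.killCompl f.injective (∏ x ∈ e, (MvPolynomial.X x : MvPolynomial V K)) =
          0 := by
        rw [map_prod]
        refine Finset.prod_eq_zero hx ?_
        rw [MvPolynomial.killCompl, MvPolynomial.aeval_X, dif_neg hxr]
      exact this ▸ Ideal.zero_mem _

end EdgeIdeal

/-! ### Counting degrees through the deck -/

section Deck

/-- A finite set of integer vectors each of which has a zero is counted by the vectors vanishing at
each vertex, weighted by the inverse of the number of zeros. -/
theorem card_eq_sum_inv_card_zeros {V : Type*} [Fintype V] (S : Finset (V → ℤ))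
    (hS : ∀ b ∈ S, ∃ x, b x = 0) :
    (S.card : ℚ) = ∑ x, ∑ b ∈ S with b x = 0, (Nat.card {y // b y = 0} : ℚ)⁻¹ := by
  simp only [Finset.sum_filter]
  -- After exchanging the sums, each `b` contributes its number of zeros times the inverse of that
  -- number, which is `1` by `hS`.
  rw [Finset.sum_comm, Finset.card_eq_sum_ones, Nat.cast_sum]
  refine Finset.sum_congr rfl fun b hb => ?_
  rw [← Finset.sum_filter, Finset.sum_const, nsmul_eq_mul, Nat.card_eq_fintype_card,
    Fintype.card_subtype, mul_inv_cancel₀, Nat.cast_one]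
  obtain ⟨x, hx⟩ := hS b hb
  exact Nat.cast_ne_zero.2 (Finset.card_ne_zero.2 ⟨x, by simpa using hx⟩)

/-- Two finite sets of integer vectors with zeros, which agree up to a bijection of the coordinates
on the vectors vanishing at any given vertex, have the same number of elements. -/
theorem card_eq_of_deck {V V' : Type*} [Fintype V] [Fintype V'] (S : Finset (V → ℤ))
    (S' : Finset (V' → ℤ)) (hS : ∀ b ∈ S, ∃ x, b x = 0) (hS' : ∀ b ∈ S', ∃ x, b x = 0)
    (σ : V ≃ V') (g : V → V ≃ V') (hg : ∀ x, g x x = σ x)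
    (h : ∀ x b, b x = 0 → (b ∈ S ↔ b ∘ (g x).symm ∈ S')) : S.card = S'.card := by
  have key : (S.card : ℚ) = S'.card := by
    rw [card_eq_sum_inv_card_zeros S hS, card_eq_sum_inv_card_zeros S' hS', ← σ.sum_comp]
    -- The summands at `x` and `σ x` agree, since `g x` matches the vectors and preserves their
    -- number of zeros.
    refine Finset.sum_congr rfl fun x _ => ?_
    refine Finset.sum_equiv ((g x).arrowCongr (Equiv.refl ℤ)) (fun b => ?_) (fun b _ => ?_)
    · have hx : ((g x).arrowCongr (Equiv.refl ℤ)) b (σ x) = b x := by simp [← hg]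
      simp only [Finset.mem_filter, hx]
      exact and_congr_left fun h0 => h x b h0
    · congr 2
      exact Nat.card_congr ((g x).subtypeEquiv fun y => by simp)
  exact_mod_cast key

/-- A bijection of the complements of two points extends to the whole types. -/
theorem exists_equiv_extending {V V' : Type*} {x : V} {x' : V'}
    (f : {w : V // w ≠ x} ≃ {w : V' // w ≠ x'}) :
    ∃ g : V ≃ V', g x = x' ∧ ∀ w : {w : V // w ≠ x}, g w = f w := by
  classical
  let u : {w : V // ¬ w ≠ x} ≃ {w : V' // ¬ w ≠ x'} :=
    { toFun := fun _ => ⟨x', by simp⟩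
      invFun := fun _ => ⟨x, by simp⟩
      left_inv := fun w => Subtype.ext (not_not.1 w.2).symm
      right_inv := fun w => Subtype.ext (not_not.1 w.2).symm }
  let g : V ≃ V' := (Equiv.sumCompl (· ≠ x)).symm.trans
    ((Equiv.sumCongr f u).trans (Equiv.sumCompl (· ≠ x')))
  refine ⟨g, ?_, fun w => ?_⟩
  · simp [g, u]
  · simp [g, w.2]

variable {K : Type v} [Field K] {V : Type u} [Finite V] {V' : Type w} [Finite V']

theorem multigradedBetti_deleteVertex (H : SimpleHypergraph V) (i : ℕ) {b : V → ℤ} {x : V}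
    (hx : b x = 0) :
    multigradedBetti K (H.deleteVertex x) i (fun w => b w) = multigradedBetti K H i b :=
  multigradedBetti_comp_embedding (Function.Embedding.subtype (· ≠ x)) H (H.deleteVertex x)
    (fun _ => Iff.rfl) i fun y hy => by
      obtain rfl : y = x := by simpa using hy
      exact hx

/-- Pass from `H` to its card, along the isomorphism of cards, and back up to `H'`; the embedding
lemma covers all three moves. -/
theorem exists_equiv_multigradedBetti {H : SimpleHypergraph V} {H' : SimpleHypergraph V'} {x : V}
    {x' : V'} (h : SimpleHypergraph.IsIsomorphic (H.deleteVertex x) (H'.deleteVertex x')) :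
    ∃ g : V ≃ V', g x = x' ∧ ∀ b : V → ℤ, b x = 0 → ∀ i,
      multigradedBetti K H' i (b ∘ g.symm) = multigradedBetti K H i b := by
  obtain ⟨f, hf⟩ := h
  obtain ⟨g, hgx, hg⟩ := exists_equiv_extending f
  refine ⟨g, hgx, fun b hb i => ?_⟩
  rw [← multigradedBetti_deleteVertex H i hb, ← multigradedBetti_deleteVertex H' i (x := x')
    (by simp [← hgx, hb]), ← multigradedBetti_comp_embedding f.toEmbedding (H'.deleteVertex x')
    (H.deleteVertex x) hf i fun y hy => absurd ⟨f.symm y, by simp⟩ hy]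
  congr 1
  funext w
  simp [← hg]

theorem exists_le_zero {V : Type*} [Fintype V] {b : V → ℤ} (hb : ∑ x, b x < Fintype.card V) :
    ∃ x, b x ≤ 0 := by
  by_contra! h
  refine hb.not_ge ?_
  calc (Fintype.card V : ℤ) = ∑ _x : V, 1 := by simp
    _ ≤ ∑ x, b x := Finset.sum_le_sum fun x _ => h x

/-- The vectors of given coordinate sum and given non-zero sequence of multigraded Betti numbers
are non-negative. -/
theorem nonneg_of_multigradedBetti {H : SimpleHypergraph V} {β : ℕ → ℕ} (hβ : β ≠ 0) {b : V → ℤ}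
    (hb : ∀ i, multigradedBetti K H i b = β i) (x : V) : 0 ≤ b x := by
  by_contra! hx
  exact hβ (funext fun i => by rw [← hb, multigradedBetti_eq_zero H i hx, Pi.zero_apply])

/-- Non-negative vectors of sum `j` lie in the box `[0, j]^V`. Finiteness is what permits the
weighted count. -/
theorem finite_setOf_multigradedBetti {V : Type u} [Fintype V] (H : SimpleHypergraph V) {β : ℕ → ℕ}
    (hβ : β ≠ 0) (j : ℤ) :
    {b : V → ℤ | ∑ x, b x = j ∧ ∀ i, multigradedBetti K H i b = β i}.Finite := by
  classical
  refine (Set.finite_Icc (0 : V → ℤ) fun _ => j).subset fun b hb => ⟨?_, fun x => ?_⟩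
  · exact nonneg_of_multigradedBetti hβ hb.2
  · rw [← hb.1]
    exact Finset.single_le_sum (fun y _ => nonneg_of_multigradedBetti hβ hb.2 y)
      (Finset.mem_univ x)

end Deck

end HypergraphReconstruction

/-! ### Reconstruction from labelled and unlabelled cards -/

theorem proposition4p7 {K : Type*} [Field K] [CharZero K] {V V' : Type*} [Fintype V] [Fintype V']
    (hn : 3 ≤ Fintype.card V) (H : HypergraphReconstruction.SimpleHypergraph V) :
    (∀ b : V → ℤ, ∑ x, b x < Fintype.card V → ∀ i : ℕ,
      (∀ x, b x = 0 →
        HypergraphReconstruction.multigradedBetti K H i b =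
          HypergraphReconstruction.multigradedBetti K (H.deleteVertex x) i (fun w => b w)) ∧
      ((∀ x, b x ≠ 0) → HypergraphReconstruction.multigradedBetti K H i b = 0)) ∧
    (∀ H' : HypergraphReconstruction.SimpleHypergraph V', H.SameDeck H' →
      ∀ j : ℤ, j < Fintype.card V → ∀ β : ℕ → ℕ, β ≠ 0 →
        {b : V → ℤ | ∑ x, b x = j ∧
          ∀ i, HypergraphReconstruction.multigradedBetti K H i b = β i}.encard =
        {b : V' → ℤ | ∑ x, b x = j ∧
          ∀ i, HypergraphReconstruction.multigradedBetti K H' i b = β i}.encard) := by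
  open HypergraphReconstruction in
  refine ⟨fun b hb i => ⟨fun x hx => (multigradedBetti_deleteVertex H i hx).symm, fun hne => ?_⟩,
    fun H' hH j hj β hβ => ?_⟩
  · obtain ⟨x, hx⟩ := exists_le_zero hb
    exact multigradedBetti_eq_zero H i (lt_of_le_of_ne hx (hne x))
  · obtain ⟨σ, hσ⟩ := hH
    choose g hgx hg using fun x => exists_equiv_multigradedBetti (K := K) (hσ x)
    have hfin := finite_setOf_multigradedBetti (K := K) H hβ j
    have hfin' := finite_setOf_multigradedBetti (K := K) H' hβ j
    rw [hfin.encard_eq_coe_toFinset_card, hfin'.encard_eq_coe_toFinset_card]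
    congr 1
    refine card_eq_of_deck _ _ (fun b hb => ?_) (fun b hb => ?_) σ g hgx fun x b hb => ?_
    · rw [Set.Finite.mem_toFinset] at hb
      obtain ⟨x, hx⟩ := exists_le_zero (hb.1.trans_lt hj)
      exact ⟨x, le_antisymm hx (nonneg_of_multigradedBetti hβ hb.2 x)⟩
    · rw [Set.Finite.mem_toFinset] at hb
      obtain ⟨x, hx⟩ := exists_le_zero (hb.1.trans_lt (hj.trans_eq (by rw [Fintype.card_congr σ])))
      exact ⟨x, le_antisymm hx (nonneg_of_multigradedBetti hβ hb.2 x)⟩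
    -- Transport along `g x` preserves the Betti sequence by `hg` and the coordinate sum by
    -- reindexing.
    · simp only [Set.Finite.mem_toFinset, Set.mem_ofPred_eq, hg x b hb]
      have : ∑ y, (b ∘ (g x).symm) y = ∑ y, b y := (g x).symm.sum_comp b
      rw [this]
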